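/- A semiring is a non-empty set with two associative binary operations $+$ and $\cdot$ such that $+$ is commutative and $\cdot$ distributes over $+$ from both sides (neither a zero nor a unity is required); a subsemiring is a non-empty subset closed under both operations. A semiring is congruence-simple if it has exactly two congruences, a congruence being an equivalence relation preserved by both operations. $\mathbf{M}_n(S)$ is the semiring of $n\times n$ matrices over $S$ with the usual addition and multiplication. For a finite lattice $L$ with $|L|\ge 2$, let $\mathrm{End}_0(L)$ be the set of all maps $f\colon L\to L$ that satisfy $f(x\vee y)=f(x)\vee f(y)$ for all $x,y\in L$ and fix the least element of $L$. It is a semiring $(\mathrm{End}_0(L),\vee,\circ)$ under $(f\vee g)(x)=f(x)\vee g(x)$ and $(f\circ g)(x)=f(g(x))$. Let $X(L)=\{f\in\mathrm{End}_0(L) : |f(L)|\le 2\}$. Theorem. Let $S$ be a finite semiring with $a+a=a$ for all $a\in S$, and let $n\ge 2$. Then $\mathbf{M}_n(S)$ is congruence-simple if and only if there are a finite lattice $L$ with $|L|\ge 2$ and a subsemiring $R$ of $(\mathrm{End}_0(L),\vee,\circ)$ with $X(L)\subseteq R$ such that $S\cong R$. -/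

import Mathlib

/-- A semiring in the sense used here: two associative operations, `+` commutative, and `*`
distributing over `+` on both sides. Neither a zero nor a unity is required. (Nonemptiness is
a separate instance argument in the theorem.) -/
class PlainSemiring (S : Type*) extends AddCommSemigroup S, Semigroup S, Distrib S

/-- `S` is congruence-simple if it has exactly two congruences. -/
def IsCongruenceSimple (S : Type*) [PlainSemiring S] : Prop :=
  Nat.card (RingCon S) = 2

/-- A subsemiring: a nonempty subset closed under both operations. -/
structure PlainSubsemiring (T : Type*) [PlainSemiring T] where
  carrier : Set T
  nonempty' : carrier.Nonempty
  add_mem' : ∀ {a b : T}, a ∈ carrier → b ∈ carrier → a + b ∈ carrier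
  mul_mem' : ∀ {a b : T}, a ∈ carrier → b ∈ carrier → a * b ∈ carrier

namespace PlainSubsemiring

variable {T : Type*} [PlainSemiring T]

instance : SetLike (PlainSubsemiring T) T where
  coe R := R.carrier
  coe_injective R R' h := by cases R; cases R'; congr

/-- A subsemiring carries the restricted addition. -/
instance : AddMemClass (PlainSubsemiring T) T where
  add_mem {R} := R.add_mem'

/-- A subsemiring carries the restricted multiplication. -/
instance : MulMemClass (PlainSubsemiring T) T where
  mul_mem {R} := R.mul_mem'

end PlainSubsemiring

/-! ### Square matrices -/

/-- The sum `f 0 + f 1 + ⋯ + f m` of a nonempty finite family (no zero element is needed). -/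
def finSum {S : Type*} [Add S] : {m : ℕ} → (Fin (m + 1) → S) → S
  | 0, f => f 0
  | _ + 1, f => finSum (fun i => f i.castSucc) + f (Fin.last _)

section FinSum

variable {S : Type*} [PlainSemiring S]

theorem finSum_add {m : ℕ} (f g : Fin (m + 1) → S) :
    finSum (fun i => f i + g i) = finSum f + finSum g := by
  induction m with
  | zero => rfl
  | succ m ih => simp only [finSum, ih]; exact add_add_add_comm _ _ _ _

theorem finSum_mul {m : ℕ} (f : Fin (m + 1) → S) (c : S) :
    finSum f * c = finSum (fun i => f i * c) := by
  induction m with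
  | zero => rfl
  | succ m ih => simp only [finSum, add_mul, ih]

theorem mul_finSum {m : ℕ} (f : Fin (m + 1) → S) (c : S) :
    c * finSum f = finSum (fun i => c * f i) := by
  induction m with
  | zero => rfl
  | succ m ih => simp only [finSum, mul_add, ih]

theorem finSum_comm {m k : ℕ} (f : Fin (m + 1) → Fin (k + 1) → S) :
    finSum (fun i => finSum (fun j => f i j)) = finSum (fun j => finSum (fun i => f i j)) := by
  induction m with
  | zero => rfl
  | succ m ih => simp only [finSum, ih, finSum_add]

end FinSum

/-- The type of `n × n` matrices over `S`. -/
def SqMat (n : ℕ) (S : Type*) : Type _ := Fin n → Fin n → S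

namespace SqMat

variable {S : Type*} [PlainSemiring S]

/-- Entrywise addition. -/
instance (n : ℕ) : Add (SqMat n S) := ⟨fun A B i j => A i j + B i j⟩

/-- The usual product, with `(i, j)` entry the sum of all `A i k * B k j`. -/
def mul : {n : ℕ} → SqMat n S → SqMat n S → SqMat n S
  | 0, _, _ => fun i => i.elim0
  | _ + 1, A, B => fun i j => finSum (fun k => A i k * B k j)

instance (n : ℕ) : Mul (SqMat n S) := ⟨mul⟩

/-- The semiring of `n × n` matrices over a semiring. -/
instance (n : ℕ) : PlainSemiring (SqMat n S) where
  add_assoc A B C := funext fun i => funext fun j => add_assoc (A i j) (B i j) (C i j)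
  add_comm A B := funext fun i => funext fun j => add_comm (A i j) (B i j)
  mul_assoc A B C := by
    cases n with
    | zero => exact funext fun i => i.elim0
    | succ n =>
      funext i j
      change finSum (fun k => finSum (fun l => A i l * B l k) * C k j)
        = finSum (fun l => A i l * finSum (fun k => B l k * C k j))
      simp only [finSum_mul, mul_finSum, mul_assoc]
      exact finSum_comm _
  left_distrib A B C := by
    cases n with
    | zero => exact funext fun i => i.elim0
    | succ n =>
      funext i j
      change finSum (fun k => A i k * (B k j + C k j))
        = finSum (fun k => A i k * B k j) + finSum (fun k => A i k * C k j)
      simp only [mul_add, finSum_add]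
  right_distrib A B C := by
    cases n with
    | zero => exact funext fun i => i.elim0
    | succ n =>
      funext i j
      change finSum (fun k => (A i k + B i k) * C k j)
        = finSum (fun k => A i k * C k j) + finSum (fun k => B i k * C k j)
      simp only [add_mul, finSum_add]

end SqMat

/-! ### The semiring of join-morphisms preserving the least element -/

/-- `End₀(L)`: the maps `L → L` that preserve binary joins and the least element. -/
def EndBot (L : Type*) [Lattice L] [OrderBot L] : Type _ := SupBotHom L L

namespace EndBot

variable {L : Type*} [Lattice L] [OrderBot L]

instance : FunLike (EndBot L) L L := inferInstanceAs (FunLike (SupBotHom L L) L L)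

/-- Addition is the pointwise join. -/
instance : Add (EndBot L) := ⟨fun f g => max (α := SupBotHom L L) f g⟩

/-- Multiplication is composition. -/
instance : Mul (EndBot L) := ⟨fun f g => SupBotHom.comp f g⟩

theorem add_apply (f g : EndBot L) (x : L) : (f + g) x = f x ⊔ g x := rfl

theorem mul_apply (f g : EndBot L) (x : L) : (f * g) x = f (g x) := rfl

/-- The semiring `(End₀(L), ∨, ∘)`. -/
instance : PlainSemiring (EndBot L) where
  add_assoc f g h := DFunLike.ext _ _ fun x => sup_assoc (f x) (g x) (h x)
  add_comm f g := DFunLike.ext _ _ fun x => sup_comm (f x) (g x)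
  mul_assoc _ _ _ := rfl
  left_distrib f g h := DFunLike.ext _ _ fun x => (SupBotHom.toSupHom f).map_sup' (g x) (h x)
  right_distrib _ _ _ := rfl

/-- `X(L)`: the members of `End₀(L)` whose image has at most two elements. -/
def smallImage (L : Type*) [Lattice L] [OrderBot L] : Set (EndBot L) :=
  {f | (Set.range f).encard ≤ 2}

end EndBot

/-! ### Congruence-simplicity -/

/-! Call a semiring of endomorphisms of `L` dense if it contains `X(L)`, which consists of the maps
`step a b`. Density forces simplicity: sandwiching a related pair of distinct maps between two step
maps relates the largest endomorphism to the zero map, and adding an arbitrary element collapses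
everything. Density also passes to matrices, which act on the power of `L` with every step map among
them. This settles one direction.

Conversely, let the matrix semiring be simple; then so is `S`. What remains is to find a zero in
`S`, ordered by `a ≤ b` iff `a + b = b`. By simplicity every matrix lies above a product of two
matrices. On matrices with minimal entries this makes each `2 × 2` pattern an outer product, and
counting leaves just one minimal element `z` (`exists_isBot`). Two annihilator-type congruences then
show that `z` is multiplicatively absorbing.

With a zero available, `S` acts on a minimal nonzero left ideal modulo equality of left
annihilators. This quotient is the lattice `L`: minimality of the ideal gives transitivity, the
order gives separation, and together they give density (`exists_dense_representation`). -/

theorem isCongruenceSimple_iff {T : Type*} [PlainSemiring T] :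
    IsCongruenceSimple T ↔
      Nontrivial T ∧ ∀ c : RingCon T, (∀ a b, c a b → a = b) ∨ ∀ a b, c a b := by
  have hbot : ∀ c : RingCon T, c = ⊥ ↔ ∀ a b, c a b → a = b := by
    intro c
    refine ⟨?_, fun h => RingCon.ext fun a b => ⟨fun hab => h a b hab, ?_⟩⟩
    · rintro rfl a b h
      exact h
    · intro hab
      have : a = b := hab
      exact this ▸ c.refl a
  have htop : ∀ c : RingCon T, c = ⊤ ↔ ∀ a b, c a b := by
    intro c
    refine ⟨?_, fun h => RingCon.ext fun a b => ⟨fun _ => trivial, fun _ => h a b⟩⟩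
    rintro rfl a b
    trivial
  rw [IsCongruenceSimple, Nat.card_eq_two_iff]
  constructor
  · rintro ⟨x, y, hxy, huniv⟩
    have hmem : ∀ c : RingCon T, c = x ∨ c = y := fun c => by
      have : c ∈ ({x, y} : Set (RingCon T)) := huniv ▸ Set.mem_univ c
      simpa using this
    have hne : (⊥ : RingCon T) ≠ ⊤ := by
      intro h
      have hsub : ∀ c : RingCon T, c = ⊥ := fun c => le_antisymm (h ▸ le_top) bot_le
      exact hxy ((hsub x).trans (hsub y).symm)
    refine ⟨?_, fun c => ?_⟩
    · by_contra hT
      rw [not_nontrivial_iff_subsingleton] at hT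
      exact hne ((htop _).2 fun a b => Subsingleton.elim a b ▸ RingCon.refl _ a)
    · rw [← hbot, ← htop]
      rcases hmem c with h | h <;> rcases hmem ⊥ with h1 | h1 <;> rcases hmem ⊤ with h2 | h2 <;>
        grind
  · rintro ⟨⟨a, b, hab⟩, h⟩
    refine ⟨⊥, ⊤, fun he => ?_, Set.eq_univ_of_forall fun c => ?_⟩
    · exact hab ((hbot ⊤).1 he.symm a b trivial)
    · rcases h c with h | h
      · exact Or.inl ((hbot c).2 h)
      · exact Or.inr ((htop c).2 h)

/-! ### Members of `End₀(L)` with small image -/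

namespace EndBot

variable {L : Type*} [Lattice L] [OrderBot L]

theorem map_sup (f : EndBot L) (x y : L) : f (x ⊔ y) = f x ⊔ f y :=
  SupHom.map_sup' (SupBotHom.toSupHom f) x y

theorem map_bot (f : EndBot L) : f ⊥ = ⊥ := SupBotHom.map_bot' f

theorem mono (f : EndBot L) {x y : L} (h : x ≤ y) : f x ≤ f y := by
  rw [← sup_eq_right, ← map_sup, sup_eq_right.2 h]

/-- An endomorphism from a map with the required properties. -/
def mk (f : L → L) (hsup : ∀ x y, f (x ⊔ y) = f x ⊔ f y) (hbot : f ⊥ = ⊥) : EndBot L :=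
  (⟨⟨f, hsup⟩, hbot⟩ : SupBotHom L L)

theorem ext {f g : EndBot L} (h : ∀ x, f x = g x) : f = g := DFunLike.ext _ _ h

open Classical in
/-- The map sending the elements below `a` to `⊥` and all others to `b`. -/
noncomputable def step (a b : L) : EndBot L :=
  mk (fun x => if x ≤ a then ⊥ else b)
    (fun x y => by by_cases hx : x ≤ a <;> by_cases hy : y ≤ a <;> simp [hx, hy])
    (by simp)

theorem step_of_le {a x : L} (b : L) (h : x ≤ a) : step a b x = ⊥ := if_pos h

theorem step_of_not_le {a x : L} (b : L) (h : ¬ x ≤ a) : step a b x = b := if_neg h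

theorem step_apply_le (a b x : L) : step a b x ≤ b := by
  by_cases h : x ≤ a
  · rw [step_of_le b h]; exact bot_le
  · rw [step_of_not_le b h]

theorem step_mem_smallImage (a b : L) : step a b ∈ smallImage L := by
  refine (Set.encard_le_encard (t := {⊥, b}) ?_).trans ?_
  swap
  · exact (Set.encard_insert_le _ _).trans (by
      rw [Set.encard_singleton]; exact le_of_eq one_add_one_eq_two)
  rintro _ ⟨x, rfl⟩
  by_cases h : x ≤ a
  · exact Or.inl (step_of_le b h)
  · exact Or.inr (step_of_not_le b h)

theorem exists_eq_step [Finite L] {f : EndBot L} (hf : f ∈ smallImage L) :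
    ∃ a b, f = step a b := by
  classical
  cases nonempty_fintype L
  obtain ⟨b, hb⟩ : ∃ b, ∀ x, f x = ⊥ ∨ f x = b := by
    by_cases h : ∃ y, f y ≠ ⊥
    · obtain ⟨y, hy⟩ := h
      refine ⟨f y, fun x => ?_⟩
      by_contra! hx
      have hsub : ({⊥, f y, f x} : Set L) ⊆ Set.range f := by
        rintro _ (rfl | rfl | rfl)
        exacts [⟨⊥, f.map_bot⟩, ⟨y, rfl⟩, ⟨x, rfl⟩]
      have h3 : ({⊥, f y, f x} : Set L).encard = 3 :=
        Set.encard_eq_three.2 ⟨_, _, _, hy.symm, hx.1.symm, hx.2.symm, rfl⟩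
      have h32 : (3 : ℕ∞) ≤ 2 := h3 ▸ (Set.encard_le_encard hsub).trans hf
      exact absurd h32 (by decide)
    · push Not at h
      exact ⟨⊥, fun x => Or.inl (h x)⟩
  -- The elements sent to `⊥` are closed under joins, so their join is the largest of them.
  let a : L := (Finset.univ.filter fun x => f x = ⊥).sup id
  have ha : f a = ⊥ :=
    Finset.sup_induction (p := fun x => f x = ⊥) f.map_bot
      (fun x hx y hy => by rw [f.map_sup, hx, hy, sup_idem])
      (fun x hx => (Finset.mem_filter.1 hx).2)
  refine ⟨a, b, ext fun x => ?_⟩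
  by_cases h : x ≤ a
  · rw [step_of_le b h]
    exact le_bot_iff.1 (ha ▸ f.mono h)
  · rw [step_of_not_le b h]
    refine (hb x).resolve_left fun hx => h ?_
    exact Finset.le_sup (f := id) (Finset.mem_filter.2 ⟨Finset.mem_univ x, hx⟩)

end EndBot

theorem exists_forall_le (L : Type*) [Lattice L] [Nonempty L] [Finite L] : ∃ t : L, ∀ x, x ≤ t := by
  cases nonempty_fintype L
  exact ⟨Finset.univ.sup' Finset.univ_nonempty id,
    fun x => Finset.le_sup' (f := id) (Finset.mem_univ x)⟩

open EndBot in
theorem isCongruenceSimple_of_dense {T L : Type*} [PlainSemiring T] [Lattice L] [OrderBot L]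
    [Finite L] [Nontrivial L] (φ : T → EndBot L) (hinj : Function.Injective φ)
    (hadd : ∀ a b, φ (a + b) = φ a + φ b) (hmul : ∀ a b, φ (a * b) = φ a * φ b)
    (hdense : smallImage L ⊆ Set.range φ) : IsCongruenceSimple T := by
  have hstep : ∀ a b, ∃ s, φ s = step a b := fun a b => hdense (step_mem_smallImage a b)
  choose e he using hstep
  obtain ⟨t, ht⟩ := exists_forall_le L
  obtain ⟨p, hp⟩ := exists_ne (⊥ : L)
  have htb : ¬ t ≤ ⊥ := fun h => hp (le_bot_iff.1 ((ht p).trans h))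
  refine isCongruenceSimple_iff.2 ⟨⟨e ⊥ t, e t t, fun h => htb ?_⟩, fun c => ?_⟩
  · have h1 := congrArg (fun s => φ s t) h
    simp only [he, step_of_le t le_rfl, step_of_not_le t htb] at h1
    exact h1.le
  by_cases hc : ∃ f g, c f g ∧ ∃ x, ¬ φ f x ≤ φ g x
  · right
    obtain ⟨f, g, hfg, x, hx⟩ := hc
    -- `step (φ g x) t` separates `φ f x` from `φ g x`, and `step ⊥ x` feeds `x` to every nonzero
    -- argument. The outcomes are the largest endomorphism and the zero map.
    have key : c (e ⊥ t) (e t t) := by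
      have h1 := c.mul (c.mul (c.refl (e (φ g x) t)) hfg) (c.refl (e ⊥ x))
      have h2 : e (φ g x) t * f * e ⊥ x = e ⊥ t := by
        refine hinj (ext fun y => ?_)
        simp only [hmul, he, EndBot.mul_apply]
        by_cases hy : y ≤ ⊥
        · rw [step_of_le _ hy, step_of_le _ hy, EndBot.map_bot, EndBot.map_bot]
        · rw [step_of_not_le _ hy, step_of_not_le _ hy, step_of_not_le _ hx]
      have h3 : e (φ g x) t * g * e ⊥ x = e t t := by
        refine hinj (ext fun y => ?_)
        simp only [hmul, he, EndBot.mul_apply]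
        rw [step_of_le _ (ht y)]
        by_cases hy : y ≤ ⊥
        · rw [step_of_le _ hy, EndBot.map_bot, EndBot.map_bot]
        · rw [step_of_not_le _ hy, step_of_le _ le_rfl]
      rwa [h2, h3] at h1
    have hall : ∀ s, c (e ⊥ t) s := by
      intro s
      have h1 := c.add (c.refl s) key
      have h2 : s + e ⊥ t = e ⊥ t := by
        refine hinj (ext fun y => ?_)
        simp only [hadd, he, EndBot.add_apply]
        by_cases hy : y ≤ ⊥
        · rw [le_bot_iff.1 hy, EndBot.map_bot, EndBot.map_bot, bot_sup_eq]
        · rw [step_of_not_le _ hy, sup_eq_right.2 (ht _)]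
      have h3 : s + e t t = s := by
        refine hinj (ext fun y => ?_)
        simp only [hadd, he, EndBot.add_apply]
        rw [step_of_le _ (ht y), sup_bot_eq]
      rwa [h2, h3] at h1
    exact fun a b => c.trans (c.symm (hall a)) (hall b)
  · left
    push Not at hc
    exact fun f g hfg => hinj (ext fun x =>
      le_antisymm (hc f g hfg x) (hc g f (c.symm hfg) x))

/-! ### Matrices acting on powers of a lattice -/

theorem EndBot.finSum_apply_le {L : Type*} [Lattice L] [OrderBot L] {m : ℕ}
    (f : Fin (m + 1) → EndBot L) (x y : L) : finSum f x ≤ y ↔ ∀ k, f k x ≤ y := by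
  induction m with
  | zero => simp [finSum, Fin.forall_fin_one]
  | succ m ih =>
    rw [finSum, EndBot.add_apply, sup_le_iff, ih]
    exact (Fin.forall_fin_succ' (P := fun k => f k x ≤ y)).symm

theorem map_finSum {S T : Type*} [Add S] [Add T] (φ : S → T)
    (hadd : ∀ a b, φ (a + b) = φ a + φ b) {m : ℕ} (f : Fin (m + 1) → S) :
    φ (finSum f) = finSum fun k => φ (f k) := by
  induction m with
  | zero => rfl
  | succ m ih => rw [finSum, hadd, ih, finSum]

theorem SqMat.mul_apply {S : Type*} [PlainSemiring S] {m : ℕ} (A B : SqMat (m + 1) S)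
    (i j : Fin (m + 1)) : (A * B) i j = finSum fun k => A i k * B k j := rfl

theorem SqMat.add_apply {S : Type*} [PlainSemiring S] {n : ℕ} (A B : SqMat n S) (i j : Fin n) :
    (A + B) i j = A i j + B i j := rfl

-- Matrices over a dense semiring are dense on the power of `L`: since `x ≤ a` fails as soon as one
-- coordinate fails, `step a b` is the matrix with entries `step (a j) (b i)`.
open EndBot in
theorem SqMat.isCongruenceSimple_of_dense {S L : Type*} [PlainSemiring S] [Lattice L] [OrderBot L]
    [Finite L] [Nontrivial L] (φ : S → EndBot L) (hinj : Function.Injective φ)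
    (hadd : ∀ a b, φ (a + b) = φ a + φ b) (hmul : ∀ a b, φ (a * b) = φ a * φ b)
    (hdense : smallImage L ⊆ Set.range φ) (m : ℕ) : IsCongruenceSimple (SqMat (m + 1) S) := by
  classical
  let Φ : SqMat (m + 1) S → EndBot (Fin (m + 1) → L) := fun A =>
    EndBot.mk (fun x i => Finset.univ.sup fun j => φ (A i j) (x j))
      (fun x y => funext fun i => by
        simp only [Pi.sup_apply, EndBot.map_sup]
        exact Finset.sup_sup)
      (funext fun i => by simp [EndBot.map_bot])
  have hΦ : ∀ A x i, Φ A x i = Finset.univ.sup fun j => φ (A i j) (x j) := fun _ _ _ => rfl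
  refine _root_.isCongruenceSimple_of_dense Φ ?_ ?_ ?_ ?_
  · intro A B h
    funext i j
    refine hinj (ext fun x => ?_)
    -- A vector supported at coordinate `j` isolates the entry in column `j`.
    have key : ∀ C, Φ C (Function.update ⊥ j x) i = φ (C i j) x := by
      intro C
      rw [hΦ]
      refine le_antisymm (Finset.sup_le fun k _ => ?_) ?_
      · by_cases hk : k = j
        · subst hk; simp
        · simp [Function.update_of_ne hk, EndBot.map_bot]
      · exact le_trans (by simp) (Finset.le_sup (Finset.mem_univ j))
    rw [← key, ← key, h]
  · intro A B
    refine ext fun x => funext fun i => ?_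
    rw [EndBot.add_apply, Pi.sup_apply, hΦ, hΦ, hΦ, ← Finset.sup_sup]
    refine congrArg _ (funext fun j => ?_)
    rw [SqMat.add_apply, hadd]; rfl
  · intro A B
    refine ext fun x => funext fun i => eq_of_forall_ge_iff fun y => ?_
    have hsup : ∀ (f : EndBot L) (g : Fin (m + 1) → L),
        f (Finset.univ.sup g) = Finset.univ.sup fun k => f (g k) := fun f g =>
      Finset.apply_sup_eq_sup_comp f f.map_sup f.map_bot
    simp only [EndBot.mul_apply, hΦ, SqMat.mul_apply, map_finSum φ hadd, hmul, hsup,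
      Finset.sup_le_iff, Finset.mem_univ, true_imp_iff, finSum_apply_le]
    exact forall_comm
  · intro F hF
    obtain ⟨a, b, rfl⟩ := exists_eq_step hF
    have hstep : ∀ a b, ∃ s, φ s = step a b := fun a b => hdense (step_mem_smallImage a b)
    choose e he using hstep
    let A : SqMat (m + 1) S := fun i j => e (a j) (b i)
    refine ⟨A, ext fun x => funext fun i => ?_⟩
    rw [hΦ, show (fun j => φ (A i j) (x j)) = fun j => step (a j) (b i) (x j) from
      funext fun j => congrArg (fun f : EndBot L => f (x j)) (he _ _)]
    by_cases hx : x ≤ a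
    · rw [step_of_le b hx]
      refine le_bot_iff.1 (Finset.sup_le fun j _ => ?_)
      rw [step_of_le _ (hx j)]
    · rw [step_of_not_le b hx]
      obtain ⟨j, hj⟩ := not_forall.1 hx
      refine le_antisymm (Finset.sup_le fun j _ => step_apply_le _ _ _) ?_
      exact (step_of_not_le (b i) hj).ge.trans
        (Finset.le_sup (f := fun j => step (a j) (b i) (x j)) (Finset.mem_univ j))

/-! ### Order-theoretic tools for additively idempotent semirings -/

theorem finSum_le_iff {S : Type*} [PlainSemiring S] [SemilatticeSup S]
    (hsup : ∀ a b : S, a + b = a ⊔ b) {m : ℕ} (f : Fin (m + 1) → S) (y : S) :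
    finSum f ≤ y ↔ ∀ k, f k ≤ y := by
  induction m with
  | zero => simp [finSum, Fin.forall_fin_one]
  | succ m ih =>
    rw [finSum, hsup, sup_le_iff, ih]
    exact (Fin.forall_fin_succ' (P := fun k => f k ≤ y)).symm

theorem mul_le_mul_of_add_eq_sup {S : Type*} [PlainSemiring S] [SemilatticeSup S]
    (hsup : ∀ a b : S, a + b = a ⊔ b) {a b c d : S} (hab : a ≤ b) (hcd : c ≤ d) :
    a * c ≤ b * d := by
  have h1 : a * c ≤ b * c := by
    rw [← sup_eq_right, ← hsup, ← add_mul, hsup, sup_eq_right.2 hab]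
  have h2 : b * c ≤ b * d := by
    rw [← sup_eq_right, ← hsup, ← mul_add, hsup, sup_eq_right.2 hcd]
  exact h1.trans h2

/-- If every `2 × 2` matrix over a finite set `P` is an outer product of two vectors over `P`,
then `P` has at most one element. -/
theorem subsingleton_of_forall_exists_mul_eq {S : Type*} [Mul S] (P : Set S) [Finite P]
    (h : ∀ A : Fin 2 → Fin 2 → P, ∃ u v : Fin 2 → P, ∀ i j, (u i : S) * v j = A i j) :
    P.Subsingleton := by
  choose u v huv using h
  let g : (Fin 2 → Fin 2 → P) → (Fin 2 → P) × (Fin 2 → P) := fun A => (u A, v A)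
  have hginj : Function.Injective g := by
    intro A B hAB
    obtain ⟨h1, h2⟩ := Prod.mk.inj hAB
    funext i j
    exact Subtype.ext (by rw [← huv, ← huv, h1, h2])
  -- Matrices and pairs of vectors are equinumerous (both `|P|^4`), so the injective `g` is
  -- bijective.
  have hgsurj : Function.Surjective g := by
    have e : (Fin 2 → Fin 2 → P) ≃ (Fin 2 → P) × (Fin 2 → P) := finTwoArrowEquiv _
    have : Function.Injective (e.symm ∘ g) := e.symm.injective.comp hginj
    intro y
    obtain ⟨A, hA⟩ := Finite.surjective_of_injective this (e.symm y)
    exact ⟨A, e.symm.injective hA⟩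
  -- A pair of constant vectors has a constant outer product. This injects `P × P` into `P`.
  have hconst : ∀ p q : P, ∃ c : P, g (fun _ _ => c) = (fun _ => p, fun _ => q) := by
    intro p q
    obtain ⟨A, hA⟩ := hgsurj (fun _ => p, fun _ => q)
    obtain ⟨h1, h2⟩ := Prod.mk.inj hA
    have hA' : A = fun _ _ => A 0 0 := by
      funext i j
      refine Subtype.ext ?_
      rw [← huv A i j, ← huv A 0 0, h1, h2]
    exact ⟨A 0 0, hA' ▸ hA⟩
  choose c hc using hconst
  have hcinj : Function.Injective fun x : P × P => c x.1 x.2 := by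
    rintro ⟨p, q⟩ ⟨p', q'⟩ h
    have h1 := (hc p q).symm.trans ((congrArg (fun c => g fun _ _ => c) h).trans (hc p' q'))
    obtain ⟨h2, h3⟩ := Prod.mk.inj h1
    exact Prod.ext (congrFun h2 0) (congrFun h3 0)
  have hcard := Nat.card_le_card_of_injective _ hcinj
  rw [Nat.card_prod] at hcard
  rw [← Set.subsingleton_coe, ← Finite.card_le_one_iff_subsingleton]
  nlinarith

/-! ### Consequences of congruence-simplicity of matrix semirings -/

namespace SqMat

/-- The matrix all of whose entries are `a`. -/
def const {S : Type*} (n : ℕ) (a : S) : SqMat n S := fun _ _ => a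

theorem const_inj {S : Type*} {m : ℕ} {a b : S} (h : const (m + 1) a = const (m + 1) b) : a = b :=
  congrFun (congrFun h 0) 0

variable {S : Type*} [PlainSemiring S]

/-- The entrywise extension of a congruence to matrices. -/
def mapCon (c : RingCon S) (m : ℕ) : RingCon (SqMat (m + 1) S) where
  r A B := ∀ i j, c (A i j) (B i j)
  iseqv := ⟨fun A i j => c.refl _, fun h i j => c.symm (h i j), fun h h' i j =>
    c.trans (h i j) (h' i j)⟩
  add' h h' i j := c.add (h i j) (h' i j)
  mul' {A B C D} h h' i j := by
    have key : ∀ {k : ℕ} (f g : Fin (k + 1) → S), (∀ l, c (f l) (g l)) →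
        c (finSum f) (finSum g) := by
      intro k f g hfg
      induction k with
      | zero => exact hfg 0
      | succ k ih => exact c.add (ih _ _ fun l => hfg _) (hfg _)
    exact key _ _ fun l => c.mul (h i l) (h' l j)

theorem entry_isCongruenceSimple {m : ℕ} (h : IsCongruenceSimple (SqMat (m + 1) S)) :
    IsCongruenceSimple S := by
  obtain ⟨⟨A, B, hAB⟩, h⟩ := isCongruenceSimple_iff.1 h
  refine isCongruenceSimple_iff.2 ⟨?_, fun c => ?_⟩
  · by_contra hS
    rw [not_nontrivial_iff_subsingleton] at hS
    exact hAB (funext fun i => funext fun j => Subsingleton.elim _ _)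
  · refine (h (mapCon c m)).imp (fun h a b hab => ?_) (fun h a b => ?_)
    · exact const_inj (h (const _ a) (const _ b) fun _ _ => hab)
    · exact h (const _ a) (const _ b) 0 0

/-- If all products agreed, then having equal `(0, 0)` entries would be a congruence, neither
equality nor total because there is a second row. -/
theorem exists_mul_ne {m : ℕ} (h : IsCongruenceSimple (SqMat (m + 2) S)) :
    ∃ A B C D : SqMat (m + 2) S, A * B ≠ C * D := by
  classical
  obtain ⟨a, b, hab⟩ := (isCongruenceSimple_iff.1 (entry_isCongruenceSimple h)).1
  by_contra! hmul
  let c : RingCon (SqMat (m + 2) S) :=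
    { r := fun A B => A 0 0 = B 0 0
      iseqv := ⟨fun _ => rfl, fun h => h.symm, fun h h' => h.trans h'⟩
      add' := fun {A B C D} h h' => by
        change A 0 0 + C 0 0 = B 0 0 + D 0 0
        rw [show A 0 0 = B 0 0 from h, show C 0 0 = D 0 0 from h']
      mul' := fun {A B C D} _ _ => by
        rw [hmul A C B D] }
  rcases (isCongruenceSimple_iff.1 h).2 c with hc | hc
  · let A : SqMat (m + 2) S := fun i _ => if i = 0 then a else b
    have h1 := congrFun (congrFun (hc A (const _ a) rfl) 1) 0
    exact hab h1.symm
  · exact hab (hc (const _ a) (const _ b))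

variable [SemilatticeSup S]

/-- The up-set `I` generated by all products absorbs addition and contains every product, so
collapsing it to a point is a congruence. As two products differ, this congruence is total, and `X ~
X * X` puts `X` in `I`. -/
theorem exists_mul_le (hsup : ∀ a b : S, a + b = a ⊔ b) {m : ℕ}
    (h : IsCongruenceSimple (SqMat (m + 2) S)) (X : SqMat (m + 2) S) :
    ∃ B C : SqMat (m + 2) S, ∀ i j, (B * C) i j ≤ X i j := by
  let I : Set (SqMat (m + 2) S) := {X | ∃ B C : SqMat (m + 2) S, ∀ i j, (B * C) i j ≤ X i j}
  have hadd : ∀ {X Y}, X ∈ I → X + Y ∈ I := by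
    rintro X Y ⟨B, C, hX⟩
    refine ⟨B, C, fun i j => ?_⟩
    rw [add_apply, hsup]
    exact (hX i j).trans le_sup_left
  have hmul : ∀ X Y, X * Y ∈ I := fun X Y => ⟨X, Y, fun i j => le_rfl⟩
  let c : RingCon (SqMat (m + 2) S) :=
    { r := fun A B => A = B ∨ A ∈ I ∧ B ∈ I
      iseqv := ⟨fun _ => Or.inl rfl, fun h => by tauto, fun {A B C} h h' => by
        rcases h with rfl | h
        · exact h'
        · rcases h' with rfl | h'
          · exact Or.inr h
          · exact Or.inr ⟨h.1, h'.2⟩⟩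
      add' := fun {A B C D} h h' => by
        rcases h with rfl | h
        · rcases h' with rfl | h'
          · exact Or.inl rfl
          · refine Or.inr ⟨?_, ?_⟩
            · rw [add_comm A]; exact hadd h'.1
            · rw [add_comm A]; exact hadd h'.2
        · exact Or.inr ⟨hadd h.1, hadd h.2⟩
      mul' := fun _ _ => Or.inr ⟨hmul _ _, hmul _ _⟩ }
  rcases (isCongruenceSimple_iff.1 h).2 c with hc | hc
  · obtain ⟨A, B, C, D, hne⟩ := exists_mul_ne h
    exact absurd (hc _ _ (Or.inr ⟨hmul A B, hmul C D⟩)) hne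
  · rcases hc X (X * X) with h1 | h1
    · rw [h1]; exact hmul X X
    · exact h1.1

theorem exists_isBot [Finite S] (hsup : ∀ a b : S, a + b = a ⊔ b) {m : ℕ}
    (h : IsCongruenceSimple (SqMat (m + 2) S)) : ∃ z : S, (∀ a, z ≤ a) ∧ z * z = z := by
  have hmin : ∀ a : S, ∃ p ≤ a, IsMin p := fun a => by
    obtain ⟨p, hp, hp'⟩ := exists_minimal_le_of_wellFoundedLT (fun _ : S => True) a trivial
    exact ⟨p, hp, fun b hb => hp'.2 trivial hb⟩
  have hprod : ∀ A : Fin 2 → Fin 2 → {p : S | IsMin p}, ∃ u v : Fin 2 → {p : S | IsMin p},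
      ∀ i j, (u i : S) * v j = A i j := by
    intro A
    -- The pattern `A` is blown up to full size by repeating its last row and column; `s` selects
    -- representative indices.
    let r : Fin (m + 2) → Fin 2 := fun i => if i = 0 then 0 else 1
    let s : Fin 2 → Fin (m + 2) := fun i => if i = 0 then 0 else 1
    have hrs : ∀ i, r (s i) = i := by
      intro i
      fin_cases i <;> simp [r, s]
    obtain ⟨B, C, hBC⟩ := exists_mul_le hsup h (fun i j => (A (r i) (r j) : S))
    choose u hu hu' using fun i => hmin (B (s i) 0)
    choose v hv hv' using fun j => hmin (C 0 (s j))
    refine ⟨fun i => ⟨u i, hu' i⟩, fun j => ⟨v j, hv' j⟩, fun i j => ?_⟩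
    -- One summand of `B * C` suffices: shrinking its factors to minimal elements keeps the product
    -- below the minimal entry of `A`, hence equal to it.
    have h1 := (finSum_le_iff hsup _ _).1 (hBC (s i) (s j)) 0
    have h2 : u i * v j ≤ A i j := by
      have := (mul_le_mul_of_add_eq_sup hsup (hu i) (hv j)).trans h1
      simpa only [hrs] using this
    exact le_antisymm h2 ((A i j).2 h2)
  have hsub := subsingleton_of_forall_exists_mul_eq {p : S | IsMin p} hprod
  obtain ⟨a, -⟩ := (isCongruenceSimple_iff.1 (entry_isCongruenceSimple h)).1
  obtain ⟨z, -, hz⟩ := hmin a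
  have hzall : ∀ p : S, IsMin p → p = z := fun p hp => hsub hp hz
  refine ⟨z, fun b => ?_, ?_⟩
  · obtain ⟨p, hpb, hp⟩ := hmin b
    exact hzall p hp ▸ hpb
  · obtain ⟨u, v, huv⟩ := hprod fun _ _ => ⟨z, hz⟩
    have h1 := huv 0 0
    rwa [hzall _ (u 0).2, hzall _ (v 0).2] at h1

theorem const_mul_const (hsup : ∀ a b : S, a + b = a ⊔ b) {m : ℕ} (a b : S) :
    const (m + 1) a * const (m + 1) b = const (m + 1) (a * b) := by
  funext i j
  rw [mul_apply]
  exact eq_of_forall_ge_iff fun y => by rw [finSum_le_iff hsup]; simp [const]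

/-- The congruence `A * C * Z = B * C * Z` for all `C` is not equality, since it identifies two
different matrices built from the top `t` and `z`. Hence it is total, and comparing `const a` with
`Z` gives the claim. -/
theorem mul_bot_of_isCongruenceSimple [Finite S] (hsup : ∀ a b : S, a + b = a ⊔ b) {m : ℕ}
    (h : IsCongruenceSimple (SqMat (m + 2) S)) {z : S} (hz : ∀ a, z ≤ a) (hzz : z * z = z) (a : S) :
    a * z = z := by
  let Z : SqMat (m + 2) S := const (m + 2) z
  have hZZ : Z * Z = Z := by rw [const_mul_const hsup, hzz]
  let c : RingCon (SqMat (m + 2) S) :=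
    { r := fun A B => ∀ C, A * C * Z = B * C * Z
      iseqv := ⟨fun _ _ => rfl, fun h C => (h C).symm, fun h h' C => (h C).trans (h' C)⟩
      add' := fun {A B D E} h h' C => by rw [add_mul, add_mul, add_mul, add_mul, h C, h' C]
      mul' := fun {A B D E} h h' C => by
        rw [mul_assoc A, h, mul_assoc B, mul_assoc B, h' C, ← mul_assoc B] }
  have hS := (isCongruenceSimple_iff.1 (entry_isCongruenceSimple h)).1
  rcases (isCongruenceSimple_iff.1 h).2 c with hc | hc
  · exfalso
    have : Nonempty S := ⟨z⟩
    cases nonempty_fintype S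
    let t : S := Finset.univ.sup' Finset.univ_nonempty id
    have ht : ∀ x : S, x ≤ t := fun x => Finset.le_sup' (f := id) (Finset.mem_univ x)
    let B : SqMat (m + 2) S := fun _ j => if j = 0 then t else z
    have htz : (const _ t : SqMat (m + 2) S) = B := by
      refine hc _ _ fun C => ?_
      funext i j
      rw [mul_assoc, mul_assoc, mul_apply, mul_apply]
      -- The top absorbs the row sum of `C`, so every summand with factor `t` equals `t * z`. Column
      -- `0` of `B` alone already contributes it.
      have hle : ∀ k, t * (C * Z) k j ≤ t * z := by
        intro k
        rw [mul_apply, show (fun l => C k l * Z l j) = fun l => C k l * z from rfl, ← finSum_mul,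
          ← mul_assoc]
        exact mul_le_mul_of_add_eq_sup hsup (ht _) le_rfl
      refine eq_of_forall_ge_iff fun y => ?_
      rw [finSum_le_iff hsup, finSum_le_iff hsup]
      refine ⟨fun hy k => ?_, fun hy k => ?_⟩
      · exact (mul_le_mul_of_add_eq_sup hsup (ht _) le_rfl).trans (hy k)
      · refine ((hle k).trans ?_).trans (hy 0)
        exact mul_le_mul_of_add_eq_sup hsup le_rfl (hz _)
    have h1 : t = z := congrFun (congrFun htz 0) 1
    obtain ⟨p, q, hpq⟩ := hS
    exact hpq ((le_antisymm (h1 ▸ ht p) (hz p)).trans (le_antisymm (h1 ▸ ht q) (hz q)).symm)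
  · have h1 := hc (const _ a) Z Z
    simp only [Z, const_mul_const hsup, hzz] at h1
    have h2 := const_inj h1
    rwa [mul_assoc, hzz] at h2

/-- The mirror image of `mul_bot_of_isCongruenceSimple`, with rows and columns exchanged. -/
theorem bot_mul_of_isCongruenceSimple [Finite S] (hsup : ∀ a b : S, a + b = a ⊔ b) {m : ℕ}
    (h : IsCongruenceSimple (SqMat (m + 2) S)) {z : S} (hz : ∀ a, z ≤ a) (hzz : z * z = z) (a : S) :
    z * a = z := by
  let Z : SqMat (m + 2) S := const (m + 2) z
  have hZZ : Z * Z = Z := by rw [const_mul_const hsup, hzz]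
  let c : RingCon (SqMat (m + 2) S) :=
    { r := fun A B => ∀ C, Z * (C * A) = Z * (C * B)
      iseqv := ⟨fun _ _ => rfl, fun h C => (h C).symm, fun h h' C => (h C).trans (h' C)⟩
      add' := fun {A B D E} h h' C => by simp only [mul_add, h C, h' C]
      mul' := fun {A B D E} h h' C => by
        rw [← mul_assoc C, h', mul_assoc C, ← mul_assoc C, ← mul_assoc Z, h C, mul_assoc Z, mul_assoc C] }
  have hS := (isCongruenceSimple_iff.1 (entry_isCongruenceSimple h)).1
  rcases (isCongruenceSimple_iff.1 h).2 c with hc | hc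
  · exfalso
    have : Nonempty S := ⟨z⟩
    cases nonempty_fintype S
    let t : S := Finset.univ.sup' Finset.univ_nonempty id
    have ht : ∀ x : S, x ≤ t := fun x => Finset.le_sup' (f := id) (Finset.mem_univ x)
    let B : SqMat (m + 2) S := fun i _ => if i = 0 then t else z
    have htz : (const _ t : SqMat (m + 2) S) = B := by
      refine hc _ _ fun C => ?_
      funext i j
      rw [← mul_assoc, ← mul_assoc, mul_apply, mul_apply]
      have hle : ∀ k, (Z * C) i k * t ≤ z * t := by
        intro k
        rw [mul_apply, show (fun l => Z i l * C l k) = fun l => z * C l k from rfl, ← mul_finSum,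
          mul_assoc]
        exact mul_le_mul_of_add_eq_sup hsup le_rfl (ht _)
      refine eq_of_forall_ge_iff fun y => ?_
      rw [finSum_le_iff hsup, finSum_le_iff hsup]
      refine ⟨fun hy k => ?_, fun hy k => ?_⟩
      · exact (mul_le_mul_of_add_eq_sup hsup le_rfl (ht _)).trans (hy k)
      · refine ((hle k).trans ?_).trans (hy 0)
        exact mul_le_mul_of_add_eq_sup hsup (hz _) le_rfl
    have h1 : t = z := congrFun (congrFun htz 1) 0
    obtain ⟨p, q, hpq⟩ := hS
    exact hpq ((le_antisymm (h1 ▸ ht p) (hz p)).trans (le_antisymm (h1 ▸ ht q) (hz q)).symm)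
  · have h1 := hc (const _ a) Z Z
    simp only [Z, const_mul_const hsup, hzz] at h1
    have h2 := const_inj h1
    rwa [← mul_assoc, hzz] at h2

end SqMat

/-! ### Representing a congruence-simple semiring with zero by dense endomorphisms -/

/-- A finite join-semilattice with least element is a lattice. -/
@[reducible] noncomputable def latticeOfFinite (L : Type*) [SemilatticeSup L] [OrderBot L]
    [Finite L] : Lattice L := by
  classical
  letI := Fintype.ofFinite L
  exact
    { (inferInstance : SemilatticeSup L) with
      inf := fun a b => (Finset.univ.filter fun c => c ≤ a ∧ c ≤ b).sup id
      inf_le_left := fun a b => Finset.sup_le fun c hc => (Finset.mem_filter.1 hc).2.1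
      inf_le_right := fun a b => Finset.sup_le fun c hc => (Finset.mem_filter.1 hc).2.2
      le_inf := fun a b c hab hac =>
        Finset.le_sup (f := id) (Finset.mem_filter.2 ⟨Finset.mem_univ a, hab, hac⟩) }

open EndBot in
theorem smallImage_subset_range {S L : Type*} [PlainSemiring S] [Lattice L] [OrderBot L]
    [Finite L] (φ : S → EndBot L) (hadd : ∀ a b, φ (a + b) = φ a + φ b)
    (hmul : ∀ a b, φ (a * b) = φ a * φ b)
    (htrans : ∀ x, x ≠ ⊥ → ∀ y, ∃ s, φ s x = y)
    (hsep : ∀ x y, ¬ x ≤ y → ∃ s, φ s y = ⊥ ∧ φ s x ≠ ⊥) (hne : ∃ s, φ s = step ⊥ ⊥) :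
    smallImage L ⊆ Set.range φ := by
  classical
  cases nonempty_fintype L
  intro f hf
  obtain ⟨a, b, rfl⟩ := exists_eq_step hf
  obtain ⟨t, ht⟩ := exists_forall_le L
  obtain ⟨z, hz⟩ := hne
  have hz' : ∀ x, φ z x = ⊥ := fun x => by
    rw [hz]; exact le_bot_iff.1 (step_apply_le _ _ _)
  by_cases hb : t = ⊥
  · refine ⟨z, EndBot.ext fun x => ?_⟩
    exact (hz' x).trans (le_bot_iff.1 (hb ▸ ht (step a b x))).symm
  -- For each `y` not below `a`, separation gives `r` killing `a` but not `y`, and transitivity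
  -- gives `q` raising the image of `y` to the top. Summing the maps `q * r` over all such `y`
  -- yields `step a t`.
  have key : ∀ F : Finset L, ∃ s, φ s a = ⊥ ∧ ∀ x ∈ F, ¬ x ≤ a → φ s x = t := by
    intro F
    induction F using Finset.induction_on with
    | empty => exact ⟨z, hz' a, by simp⟩
    | insert y F _ ih =>
      obtain ⟨s, hs, hsF⟩ := ih
      by_cases hy : y ≤ a
      · refine ⟨s, hs, fun x hx hxa => ?_⟩
        rcases Finset.mem_insert.1 hx with rfl | hx
        · exact absurd hy hxa
        · exact hsF x hx hxa
      · obtain ⟨r, hr, hry⟩ := hsep y a hy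
        obtain ⟨q, hq⟩ := htrans _ hry t
        refine ⟨s + q * r, ?_, fun x hx hxa => ?_⟩
        · rw [hadd, EndBot.add_apply, hmul, EndBot.mul_apply, hs, hr, EndBot.map_bot, bot_sup_eq]
        · rw [hadd, EndBot.add_apply, hmul, EndBot.mul_apply]
          rcases Finset.mem_insert.1 hx with rfl | hx
          · rw [hq, sup_eq_right.2 (ht _)]
          · rw [hsF x hx hxa, sup_eq_left.2 (ht _)]
  obtain ⟨s, hs, hsu⟩ := key Finset.univ
  obtain ⟨q, hq⟩ := htrans t hb b
  refine ⟨q * s, EndBot.ext fun x => ?_⟩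
  rw [hmul, EndBot.mul_apply]
  by_cases hx : x ≤ a
  · have hsx : φ s x = ⊥ := le_bot_iff.1 (hs ▸ (φ s).mono hx)
    rw [step_of_le b hx, hsx, EndBot.map_bot]
  · rw [step_of_not_le b hx, hsu x (Finset.mem_univ x) hx, hq]

/-- A finite family of sets can be indexed injectively by a finite type in any universe. -/
theorem exists_index_of_finite {α β : Type*} [Finite α] (f : α → β) :
    ∃ (L : Type*) (_ : Finite L) (r : L → α) (q : α → L),
      (∀ x, f (r (q x)) = f x) ∧ ∀ l m, f (r l) = f (r m) → l = m := by
  have e := Finite.equivFin (Set.range f)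
  have h : ∀ l : ULift (Fin (Nat.card (Set.range f))), ∃ x, f x = (e.symm l.down : β) :=
    fun l => (e.symm l.down).2
  choose r hr using h
  refine ⟨ULift (Fin (Nat.card (Set.range f))), inferInstance, r,
    fun x => ⟨e ⟨f x, x, rfl⟩⟩, fun x => ?_, fun l m hlm => ?_⟩
  · rw [hr, Equiv.symm_apply_apply]
  · rw [hr, hr] at hlm
    exact ULift.ext _ _ (e.symm.injective (Subtype.ext hlm))

section Representation

variable {S : Type*} [PlainSemiring S] {z : S}

/-- Having the same left multiples is a congruence. Were it total, each `a * b` would equal `a * z =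
z`. -/
theorem eq_bot_of_forall_mul_eq_bot (hS : IsCongruenceSimple S) (hmz : ∀ a, a * z = z)
    (hne : ∃ a b : S, a * b ≠ z) {x : S} (hx : ∀ s, s * x = z) : x = z := by
  let c : RingCon S :=
    { r := fun a b => ∀ s, s * a = s * b
      iseqv := ⟨fun _ _ => rfl, fun h s => (h s).symm, fun h h' s => (h s).trans (h' s)⟩
      add' := fun h h' s => by rw [mul_add, mul_add, h, h']
      mul' := fun {a b a' b'} h h' s => by
        rw [← mul_assoc, h', h, mul_assoc] }
  rcases (isCongruenceSimple_iff.1 hS).2 c with hc | hc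
  · exact hc x z fun s => by rw [hx, hmz]
  · obtain ⟨a, b, hab⟩ := hne
    exact absurd ((hc b z a).trans (hmz a)) hab

/-- There is a minimal nonzero left ideal. -/
theorem exists_minimal_leftIdeal [Finite S] (hzm : ∀ a, z * a = z)
    (hN : ∀ x : S, (∀ s, s * x = z) → x = z) (hne : ∃ a : S, a ≠ z) :
    ∃ I : Set S, (∀ x ∈ I, x ≠ z → ∀ y ∈ I, ∃ s, s * x = y) ∧ (∃ x ∈ I, x ≠ z) ∧ z ∈ I ∧
      (∀ x ∈ I, ∀ y ∈ I, x + y ∈ I) ∧ ∀ s, ∀ x ∈ I, s * x ∈ I := by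
  let I : S → Set S := fun x => Set.range fun s => s * x
  -- Choose a principal left ideal of least cardinality among those generated by nonzero elements;
  -- any nonzero member then generates all of it.
  obtain ⟨x, hx, hmin⟩ := Set.exists_min_image {x : S | x ≠ z} (fun x => (I x).ncard)
    (Set.toFinite _) hne
  refine ⟨I x, ?_, ?_, ⟨z, hzm x⟩, ?_, ?_⟩
  · rintro y ⟨s, rfl⟩ hy w hw
    have hsub : I (s * x) ⊆ I x := by
      rintro _ ⟨r, rfl⟩
      exact ⟨r * s, mul_assoc _ _ _⟩
    have heq := Set.eq_of_subset_of_ncard_le hsub (hmin _ hy) (Set.toFinite _)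
    exact (heq ▸ hw : w ∈ I (s * x))
  · by_contra! h
    exact hx (hN x fun s => h _ ⟨s, rfl⟩)
  · rintro _ ⟨s, rfl⟩ _ ⟨r, rfl⟩
    exact ⟨s + r, add_mul _ _ _⟩
  · rintro s _ ⟨r, rfl⟩
    exact ⟨s * r, mul_assoc _ _ _⟩

open EndBot in
theorem exists_dense_representation [SemilatticeSup S] [Finite S] (hsup : ∀ a b : S, a + b = a ⊔ b)
    (hS : IsCongruenceSimple S) (hz : ∀ a, z ≤ a) (hmz : ∀ a, a * z = z)
    (hzm : ∀ a, z * a = z) (hne : ∃ a b : S, a * b ≠ z) :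
    ∃ (L : Type*) (_ : Lattice L) (_ : OrderBot L) (_ : Finite L) (_ : Nontrivial L)
      (φ : S → EndBot L), Function.Injective φ ∧ (∀ a b, φ (a + b) = φ a + φ b) ∧
        (∀ a b, φ (a * b) = φ a * φ b) ∧ smallImage L ⊆ Set.range φ := by
  have hN := fun x => eq_bot_of_forall_mul_eq_bot (x := x) hS hmz hne
  obtain ⟨I, htrans, ⟨x₀, hx₀, hx₀z⟩, hzI, haddI, hmulI⟩ :=
    exists_minimal_leftIdeal hzm hN (by
      obtain ⟨a, b, hab⟩ := hne
      exact ⟨_, hab⟩)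
  let ann : I → Set S := fun x => {t | t * (x : S) = z}
  obtain ⟨L, hL, r, q, hrq, hrinj⟩ := exists_index_of_finite ann
  have hann : ∀ x t, t * (r (q x) : S) = z ↔ t * (x : S) = z := fun x t =>
    Set.ext_iff.1 (hrq x) t
  have hsum : ∀ a b : S, a + b = z ↔ a = z ∧ b = z := fun a b => by
    rw [hsup]
    exact ⟨fun h => ⟨le_antisymm (h ▸ le_sup_left) (hz _), le_antisymm (h ▸ le_sup_right) (hz _)⟩,
      fun h => by rw [h.1, h.2, sup_idem]⟩
  -- The order is reverse inclusion of left annihilators. A sum is `z` only if both summands are, so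
  -- addition in `I` induces joins.
  let : PartialOrder L :=
    { le := fun l m => ∀ t, t * (r m : S) = z → t * (r l : S) = z
      le_refl := fun l t h => h
      le_trans := fun l m n h h' t ht => h t (h' t ht)
      le_antisymm := fun l m h h' => hrinj l m (Set.ext fun t => ⟨h' t, h t⟩) }
  have hle : ∀ l m : L, l ≤ m ↔ ∀ t, t * (r m : S) = z → t * (r l : S) = z := fun _ _ => Iff.rfl
  let : SemilatticeSup L :=
    { sup := fun l m => q ⟨r l + r m, haddI _ (r l).2 _ (r m).2⟩
      le_sup_left := fun l m t h => by
        rw [hann, mul_add, hsum] at h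
        exact h.1
      le_sup_right := fun l m t h => by
        rw [hann, mul_add, hsum] at h
        exact h.2
      sup_le := fun l m n h h' t ht => by
        rw [hann, mul_add, hsum]
        exact ⟨h t ht, h' t ht⟩ }
  have hsupL : ∀ l m : L, ∀ t, t * (r (l ⊔ m) : S) = z ↔ t * (r l : S) = z ∧ t * (r m : S) = z :=
    fun l m t => by
      rw [← hsum, ← mul_add]
      exact hann _ _
  let : OrderBot L :=
    { bot := q ⟨z, hzI⟩
      bot_le := fun l t _ => (hann _ _).2 (hmz t) }
  have hbot : ∀ l : L, l = ⊥ ↔ (r l : S) = z := by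
    intro l
    rw [← le_bot_iff, hle]
    refine ⟨fun h => hN _ fun s => h s ((hann _ _).2 (hmz s)), fun h t _ => ?_⟩
    rw [h, hmz]
  let : Lattice L := latticeOfFinite L
  let act : S → L → L := fun s l => q ⟨s * r l, hmulI s _ (r l).2⟩
  have hact : ∀ s l t, t * (r (act s l) : S) = z ↔ t * s * (r l : S) = z := fun s l t => by
    rw [hann, mul_assoc]
  have hLext : ∀ l m : L, (∀ t, t * (r l : S) = z ↔ t * (r m : S) = z) → l = m := fun l m h =>
    hrinj l m (Set.ext h)
  let φ : S → EndBot L := fun s => EndBot.mk (act s)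
    (fun x y => hLext _ _ fun t => by simp only [hact, hsupL])
    ((hbot _).2 (hN _ fun t => by rw [hact, (hbot ⊥).1 rfl, hmz]))
  have hφ : ∀ s l, φ s l = act s l := fun _ _ => rfl
  have hφbot : ∀ s l, φ s l = ⊥ ↔ s * (r l : S) = z := by
    intro s l
    rw [hbot, hφ]
    refine ⟨fun h => hN _ fun t => ?_, fun h => hN _ fun t => ?_⟩
    · rw [← mul_assoc, ← hact, h, hmz]
    · rw [hact, mul_assoc, h, hmz]
  have hqx₀ : q ⟨x₀, hx₀⟩ ≠ ⊥ := fun h => hx₀z (hN _ fun s => by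
    rw [← hann ⟨x₀, hx₀⟩, (hbot _).1 h, hmz])
  have hadd : ∀ a b, φ (a + b) = φ a + φ b := fun a b => EndBot.ext fun l =>
    hLext _ _ fun t => by
      rw [EndBot.add_apply, hsupL, hφ, hφ, hφ, hact, hact, hact, mul_add, add_mul, hsum]
  have hmul : ∀ a b, φ (a * b) = φ a * φ b := fun a b => EndBot.ext fun l =>
    hLext _ _ fun t => by
      rw [EndBot.mul_apply, hφ, hφ, hφ, hact, hact, hact, mul_assoc t a b]
  refine ⟨L, inferInstance, inferInstance, hL, ⟨_, _, hqx₀⟩, φ, ?_, hadd, hmul,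
    smallImage_subset_range φ hadd hmul ?_ ?_ ⟨z, EndBot.ext fun l => ?_⟩⟩
  -- The kernel of `φ` is a congruence. If it were total, every `s` would act as `z` does and kill
  -- the nonzero class of `x₀`.
  · let c : RingCon S :=
      { r := fun a b => φ a = φ b
        iseqv := ⟨fun _ => rfl, fun h => h.symm, fun h h' => h.trans h'⟩
        add' := fun h h' => by rw [hadd, hadd, h, h']
        mul' := fun h h' => by rw [hmul, hmul, h, h'] }
    rcases (isCongruenceSimple_iff.1 hS).2 c with hc | hc
    · exact fun a b h => hc a b h
    · exfalso
      refine hqx₀ ((hbot _).2 (hN _ fun s => ?_))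
      rw [← hφbot, show φ s = φ z from hc s z, hφbot, hzm]
  · intro l hl m
    obtain ⟨s, hs⟩ := htrans _ (r l).2 (fun h => hl ((hbot l).2 h)) _ (r m).2
    exact ⟨s, hLext _ _ fun t => by rw [hφ, hact, mul_assoc, hs]⟩
  · intro l m h
    rw [hle] at h
    push Not at h
    obtain ⟨t, h1, h2⟩ := h
    exact ⟨t, (hφbot t m).2 h1, fun h => h2 ((hφbot t l).1 h)⟩
  · rw [(hφbot z l).2 (hzm _), le_bot_iff.1 (step_apply_le _ _ _)]

end Representation

/-! ### The characterisation -/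

theorem mainTheorem5 {S : Type*} [PlainSemiring S] [Nonempty S] [Finite S]
    (hS : ∀ a : S, a + a = a) (n : ℕ) (hn : 2 ≤ n) :
    IsCongruenceSimple (SqMat n S) ↔
      ∃ (L : Type*) (_ : Lattice L) (_ : OrderBot L) (_ : Finite L) (_ : Nontrivial L)
        (R : PlainSubsemiring (EndBot L)),
        EndBot.smallImage L ⊆ (R : Set (EndBot L)) ∧ Nonempty (S ≃+* R) := by
  obtain ⟨m, rfl⟩ := Nat.exists_eq_add_of_le' hn
  constructor
  · intro h
    let : Max S := ⟨fun a b => a + b⟩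
    let : SemilatticeSup S := SemilatticeSup.mk' add_comm add_assoc hS
    have hsup : ∀ a b : S, a + b = a ⊔ b := fun _ _ => rfl
    obtain ⟨z, hz, hzz⟩ := SqMat.exists_isBot hsup h
    have hmz := SqMat.mul_bot_of_isCongruenceSimple hsup h hz hzz
    have hzm := SqMat.bot_mul_of_isCongruenceSimple hsup h hz hzz
    have hne : ∃ a b : S, a * b ≠ z := by
      by_contra! hall
      obtain ⟨A, B, C, D, hABCD⟩ := SqMat.exists_mul_ne h
      refine hABCD (funext fun i => funext fun j => ?_)
      simp only [SqMat.mul_apply, hall]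
    obtain ⟨L, _, _, hL, hL', φ, hinj, hadd, hmul, hdense⟩ :=
      exists_dense_representation hsup (SqMat.entry_isCongruenceSimple h) hz hmz hzm hne
    let R : PlainSubsemiring (EndBot L) :=
      { carrier := Set.range φ
        nonempty' := ⟨φ z, z, rfl⟩
        add_mem' := by
          rintro _ _ ⟨a, rfl⟩ ⟨b, rfl⟩
          exact ⟨a + b, hadd a b⟩
        mul_mem' := by
          rintro _ _ ⟨a, rfl⟩ ⟨b, rfl⟩
          exact ⟨a * b, hmul a b⟩ }
    exact ⟨L, inferInstance, inferInstance, hL, hL', R, hdense,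
      ⟨{ Equiv.ofInjective φ hinj with
          map_mul' := fun a b => Subtype.ext (hmul a b)
          map_add' := fun a b => Subtype.ext (hadd a b) }⟩⟩
  · rintro ⟨L, _, _, _, _, R, hR, ⟨e⟩⟩
    refine SqMat.isCongruenceSimple_of_dense (fun s => (e s : EndBot L))
      (Subtype.val_injective.comp e.injective) (fun a b => ?_) (fun a b => ?_) ?_ (m + 1)
    · exact congrArg Subtype.val (map_add e a b)
    · exact congrArg Subtype.val (map_mul e a b)
    · intro f hf
      exact ⟨e.symm ⟨f, hR hf⟩, congrArg Subtype.val (e.apply_symm_apply _)⟩
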